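/- **Setting.** Let $L,\nu>0$, $\Omega=[0,L]^3$ the periodic box, $\lambda_1=4\pi^2/L^2$. For $s=0,1,2$ let $\dot V_s$ be the space of real, mean-free, divergence-free fields $u(x)=\sum_{K\in\mathbb Z^3\setminus\{0\}}\hat u_Ke^{2\pi iK\cdot x/L}$ with $\|u\|_{\dot V_s}^2=L^3\sum_K(2\pi|K|/L)^{2s}|\hat u_K|^2<\infty$, and write $H=\dot V_0$, $V=\dot V_1$, $D(A)=\dot V_2$, $\|u\|=\|u\|_H$, $\|\nabla u\|=\|u\|_V$. Let $A=-\Delta$, let $\mathcal P$ be the Helmholtz–Leray projection, $B(u,v)=\mathcal P[(u\cdot\nabla)v]$, and let $P_N$ be the projection onto the Fourier modes with $0<|K|<N$. Let $f\in L^\infty([0,\infty);H)$ and write $\sup_{s\ge0}\|f(s)\|$ for its (essential) supremum norm. A solution on a time interval $I$ of $\frac{d}{dt}(u+a^2Au)+\nu A(u+a^2Au)+B(u,u)=F$ is a $u\in C(I;V)\cap L^2_{loc}(I;D(A))$ that satisfies the equation in $D(A)'=\dot V_{-2}$, integrated in time. Let $0<\alpha_0\le\alpha\le\alpha_1$, and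 let $u$ be a solution on $[0,\infty)$ of the simplified Bardina system $$\frac{dv}{dt}+\nu Av+B(u,u)=f,\qquad v=u+\alpha^2Au,$$ with $\|u(0)\|\le M_A$ and $\|\nabla u(0)\|\le M_B$. Let $n\ge1$, $0\le t_n<t_{n+1}$, $\beta_n>0$, $\eta_n>0$, $N_n\in\mathbb N$ with $N_n\ge1$, and let $w_n$ be a solution on $[t_n,t_{n+1}]$ of the nudged system $$\frac{dz_n}{dt}+\nu Az_n+B(w_n,w_n)=f-\eta_n(I+\beta_n^2A)\mathcal P(P_{N_n}w_n-P_{N_n}u),\qquad z_n=w_n+\beta_n^2Aw_n,$$ with $w_n(t_n)=w_{n-1}(t_n)$, where $w_{n-1}(t_n)$ is the final value of the previous step (for $n=1$: the prescribed initial datum). Put $$M_1^2(t)=e^{-\nu\lambda_1t}\left(M_A^2+\alpha_1^2M_B^2\right)+\frac1{\lambda_1^2\nu^2}\sup_{s\ge0}\|f(s)\|^2,$$ $$M^2_{(4,n)}(t,\eta_n)=e^{-\frac{\eta_n}2(t-t_n)}\left(\|w_{n-1}(t_n)\|^2+\beta_n^2\|\nabla w_{n-1}(t_n)\|^2\right)+\frac4{\eta_n^2}\sup_{r\ge0}\|f(r)\|^2+2\left(2+\frac{\beta_n^2}{\alpha_0^2}\right)M_1^2(t_n).$$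 **Proposition 5.4.** If $\dfrac{\eta_n}{N_n^2}\le\dfrac{\nu\lambda_1}2$, then for all $t\in[t_n,t_{n+1}]$ $$\|w_n(t)\|^2+\beta_n^2\|\nabla w_n(t)\|^2\le M^2_{(4,n)}(t,\eta_n).$$ -/

import Mathlib

open MeasureTheory Set Filter Topology

noncomputable section

namespace Bardina

/-- Wave numbers `K ∈ ℤ³`. -/
abbrev Wave : Type := Fin 3 → ℤ

/-- A (generalized) vector field on the torus `[0,L]³`, given by its Fourier coefficients:
`u(x) = ∑_K û_K e^{2πi K·x/L}` with `û_K ∈ ℂ³`.  Here `u K` is `û_K`. -/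
abbrev Field : Type := Wave → EuclideanSpace ℂ (Fin 3)

/-- `|K|²`. -/
def waveSq (K : Wave) : ℝ := ∑ j, (K j : ℝ) ^ 2

/-- The bilinear (not sesquilinear) product `a · K = ∑_j a_j K_j` for `a ∈ ℂ³`. -/
def dotWave (a : EuclideanSpace ℂ (Fin 3)) (K : Wave) : ℂ := ∑ j, a j * (K j : ℂ)

/-- `λ₁ = 4π²/L²`. -/
def lam1 (L : ℝ) : ℝ := 4 * Real.pi ^ 2 / L ^ 2

/-- The eigenvalue `4π²|K|²/L² = (2π|K|/L)²` of the Stokes operator on the mode `K`. -/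
def eig (L : ℝ) (K : Wave) : ℝ := lam1 L * waveSq K

/-- Membership in the space `V_s` of real, mean-free, divergence-free fields with
`∑_K |K|^{2s} |û_K|² < ∞`, for integers `s ≥ 0`.  So `H`, `V`, `D(A)` are the cases
`s = 0, 1, 2`. -/
structure MemV (s : ℕ) (u : Field) : Prop where
  mean_zero : u 0 = 0
  real : ∀ K j, u K j = star (u (-K) j)
  div_free : ∀ K, dotWave (u K) K = 0
  summable : Summable fun K : Wave => waveSq K ^ s * ‖u K‖ ^ 2

/-- The squared norm `L³ ∑_K (2π|K|/L)^{2s} |û_K|²` of `V_s`.  For `s = 0, 1, 2` this is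
`‖u‖²`, `‖∇u‖²`, `‖Au‖²` respectively (`L²` norms over `[0,L]³`). -/
def normSq (L : ℝ) (s : ℕ) (u : Field) : ℝ := L ^ 3 * ∑' K : Wave, eig L K ^ s * ‖u K‖ ^ 2

/-- The Stokes operator `A = -Δ`. -/
def stokes (L : ℝ) (u : Field) : Field := fun K => (eig L K : ℂ) • u K

/-- `(I + a² A) u`. -/
def helmholtz (L a : ℝ) (u : Field) : Field := u + ((a ^ 2 : ℝ) : ℂ) • stokes L u

/-- The Helmholtz–Leray projection `û_K ↦ û_K - K (û_K · K) / |K|²` for `K ≠ 0`; the mean is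
removed. -/
def leray (u : Field) : Field := fun K =>
  if K = 0 then 0
  else u K - (dotWave (u K) K / (waveSq K : ℂ)) • WithLp.toLp 2 (fun j => (K j : ℂ))

/-- The projection `P_N` onto the modes `0 < |K| < N`. -/
def lowModes (N : ℕ) (u : Field) : Field := fun K =>
  if K ≠ 0 ∧ waveSq K < (N : ℝ) ^ 2 then u K else 0

/-- The field `(u · ∇) v = ∑_j u_j ∂_j v`.  Its coefficient at `K` is the Cauchy product
`∑_J (2πi/L) (û_J · (K - J)) v̂_{K-J}` of the Fourier series of `u_j` and `∂_j v`; the sum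
converges absolutely for all `u ∈ H`, `v ∈ V`. -/
def advect (L : ℝ) (u v : Field) : Field := fun K =>
  ∑' J : Wave, (2 * Real.pi * Complex.I / L * dotWave (u J) (K - J)) • v (K - J)

/-- The bilinear operator `B(u,v) = 𝒫[(u · ∇) v]`. -/
def bilin (L : ℝ) (u v : Field) : Field := leray (advect L u v)

/-- `f ∈ L^∞([0,∞); H)`.  As `H` is separable, measurability of all Fourier coefficients is
the same as strong measurability of the `H`-valued map. -/
structure MemLinfH (L : ℝ) (f : ℝ → Field) : Prop where
  measurable : ∀ K, AEStronglyMeasurable (fun t => f t K) (volume.restrict (Ici 0))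
  mem : ∀ᵐ t ∂(volume.restrict (Ici (0 : ℝ))), MemV 0 (f t)
  bounded : MemLp (fun t => Real.sqrt (normSq L 0 (f t))) ⊤ (volume.restrict (Ici 0))

/-- `sup_{s ≥ 0} ‖f(s)‖`, the norm of `f` in `L^∞([0,∞); H)` (an essential supremum). -/
def supNorm (L : ℝ) (f : ℝ → Field) : ℝ :=
  (eLpNorm (fun t => Real.sqrt (normSq L 0 (f t))) ⊤ (volume.restrict (Ici 0))).toReal

/-- `u` is a (regular) solution, on the time interval `I`, of
`dv/dt + ν A v + B(u,u) = F`, `v = u + a² A u`, `∇·u = ∇·v = 0`: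
`u ∈ C(I; V) ∩ L²_loc(I; D(A))`, and the equation holds in `D' = V_{-2}`, that is for each
Fourier coefficient, in the form integrated over time (so `v` is absolutely continuous with
values in `D'` and the equation holds there for almost every time). -/
structure IsSolution (L ν a : ℝ) (F : ℝ → Field) (I : Set ℝ) (u : ℝ → Field) : Prop where
  mem_V : ∀ t ∈ I, MemV 1 (u t)
  continuous_V : ∀ t₀ ∈ I, Tendsto (fun t => normSq L 1 (u t - u t₀)) (𝓝[I] t₀) (𝓝 0)
  mem_DA : ∀ᵐ t ∂(volume.restrict I), MemV 2 (u t)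
  sq_integrable_DA : ∀ t₀ ∈ I, ∀ t₁ ∈ I,
    IntegrableOn (fun t => normSq L 2 (u t)) (Icc t₀ t₁)
  integrable : ∀ K, ∀ t₀ ∈ I, ∀ t₁ ∈ I, IntervalIntegrable
    (fun s => F s K - (ν : ℂ) • stokes L (helmholtz L a (u s)) K - bilin L (u s) (u s) K)
    volume t₀ t₁
  equation : ∀ K, ∀ t₀ ∈ I, ∀ t₁ ∈ I,
    helmholtz L a (u t₁) K - helmholtz L a (u t₀) K =
      ∫ s in t₀..t₁,
        (F s K - (ν : ℂ) • stokes L (helmholtz L a (u s)) K - bilin L (u s) (u s) K)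

/-- `u` solves the simplified Bardina system with length scale `α` for all times `t ≥ 0`. -/
def IsBardinaSolution (L ν α : ℝ) (f u : ℝ → Field) : Prop :=
  IsSolution L ν α f (Ici 0) u

/-- `w` solves, on the time interval `I`, the nudged Bardina system
`dz/dt + ν A z + B(w,w) = f - η (I + β² A) 𝒫 (P_N w - P_N u)`, `z = w + β² A w`. -/
def IsNudgedSolution (L ν β η : ℝ) (N : ℕ) (f u : ℝ → Field) (I : Set ℝ) (w : ℝ → Field) :
    Prop :=
  IsSolution L ν β
    (fun t => f t -
      (η : ℂ) • helmholtz L β (leray (lowModes N (w t) - lowModes N (u t)))) I w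

/-- `M₁²(t) = e^{-νλ₁t} (M_A² + α₁² M_B²) + (λ₁ν)^{-2} sup_{s≥0} ‖f(s)‖²`. -/
def M1sq (L ν α₁ MA MB : ℝ) (f : ℝ → Field) (t : ℝ) : ℝ :=
  Real.exp (-(ν * lam1 L * t)) * (MA ^ 2 + α₁ ^ 2 * MB ^ 2) +
    1 / (lam1 L ^ 2 * ν ^ 2) * supNorm L f ^ 2

/-- `M²_{(4,n)}(t,η_n)`, where `tₙ`, `β`, `η` are the data of the step `n` and
`wprev = w_{n-1}(t_n)`:
`e^{-η(t-tₙ)/2} (‖wprev‖² + β²‖∇wprev‖²) + (4/η²) sup ‖f‖² + 2 (2 + β²/α₀²) M₁²(tₙ)`. -/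
def M4sq (L ν α₀ α₁ MA MB : ℝ) (f : ℝ → Field) (tₙ β : ℝ) (wprev : Field) (t η : ℝ) : ℝ :=
  Real.exp (-(η / 2 * (t - tₙ))) * (normSq L 0 wprev + β ^ 2 * normSq L 1 wprev) +
    4 / η ^ 2 * supNorm L f ^ 2 +
    2 * (2 + β ^ 2 / α₀ ^ 2) * M1sq L ν α₁ MA MB f tₙ

end Bardina

end

noncomputable section

namespace Bardina

/-! This is an energy estimate. Tested with `w`, the nonlinear term does no work, so the energy
`‖w‖² + β²‖∇w‖²` changes only through viscosity, forcing and nudging. On the mode `K`, viscosity and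
nudging both carry the Helmholtz weight `m = 1 + β²(2π|K|/L)²`. For `|K| < N` the nudging supplies
the damping. For `|K| ≥ N` viscosity does, because the hypothesis gives `νλ₁|K|² ≥ νλ₁N² ≥ 2η`. So
every mode decays at rate `η/2`, up to the source `(2/η)|f̂|² + ηm|û|²` (`nudgedMode_le`). Summing
and dividing by the rate gives `(4/η²) sup ‖f‖² + 2 sup (‖u‖² + β²‖∇u‖²)`. The same argument with
rate `νλ₁` bounds `‖u‖² + α²‖∇u‖²` by `M₁²`, and `α ≥ α₀` converts the `α`-energy of `u` into its
`β`-energy.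

Both systems go through `IsSolution.energy_le`. The energy identity is proved on finite sets of
modes, where it is a product rule for absolutely continuous functions, and then the set exhausts the
lattice. The truncated nonlinear work tends to zero at almost every time, by antisymmetry of the
triads. It is dominated by a constant times `‖∇w‖²(1 + ‖Aw‖²)`, integrable in time because `w ∈
C(I;V) ∩ L²_loc(I;D(A))`. -/

/-! ### Wave numbers and lattice sums. -/

lemma waveSq_nonneg (K : Wave) : 0 ≤ waveSq K := Finset.sum_nonneg fun _ _ => sq_nonneg _

@[simp] lemma waveSq_zero : waveSq 0 = 0 := by simp [waveSq]

lemma waveSq_eq_intCast (K : Wave) : waveSq K = ((∑ j, K j ^ 2 : ℤ) : ℝ) := by simp [waveSq]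

lemma one_le_waveSq {K : Wave} (hK : K ≠ 0) : 1 ≤ waveSq K := by
  rw [waveSq_eq_intCast]
  obtain ⟨j, hj⟩ := Function.ne_iff.mp hK
  have h1 : 0 < K j ^ 2 := by have : K j ≠ 0 := hj; positivity
  have h2 : K j ^ 2 ≤ ∑ j, K j ^ 2 :=
    Finset.single_le_sum (f := fun j => K j ^ 2) (fun _ _ => sq_nonneg _) (Finset.mem_univ j)
  exact_mod_cast (show (1 : ℤ) ≤ ∑ j, K j ^ 2 by omega)

lemma lam1_pos {L : ℝ} (hL : 0 < L) : 0 < lam1 L := by unfold lam1; positivity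

lemma eig_nonneg {L : ℝ} (hL : 0 < L) (K : Wave) : 0 ≤ eig L K :=
  mul_nonneg (lam1_pos hL).le (waveSq_nonneg K)

lemma lam1_le_eig {L : ℝ} (hL : 0 < L) {K : Wave} (hK : K ≠ 0) : lam1 L ≤ eig L K :=
  le_mul_of_one_le_right (lam1_pos hL).le (one_le_waveSq hK)

lemma norm_dotWave_le (a : EuclideanSpace ℂ (Fin 3)) (K : Wave) :
    ‖dotWave a K‖ ≤ ‖a‖ * Real.sqrt (waveSq K) := by
  rw [EuclideanSpace.norm_eq]
  calc ‖dotWave a K‖ ≤ ∑ j, ‖a j‖ * |(K j : ℝ)| := by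
        refine (norm_sum_le _ _).trans (le_of_eq (Finset.sum_congr rfl fun j _ => ?_))
        rw [norm_mul, Complex.norm_intCast]
    _ ≤ _ := by
        have := Real.sum_mul_le_sqrt_mul_sqrt Finset.univ (fun j => ‖a j‖) (fun j => |(K j : ℝ)|)
        simpa [waveSq] using this

lemma dotWave_sub (a : EuclideanSpace ℂ (Fin 3)) (K J : Wave) :
    dotWave a (K - J) = dotWave a K - dotWave a J := by
  simp [dotWave, mul_sub, Finset.sum_sub_distrib]

/-- The lattice has rank 3 and the exponent 4 exceeds it. The sup norm of `K` is at most `|K|`, so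
the lattice sum in that norm dominates. The zero mode contributes `0⁻¹ = 0`. -/
lemma summable_inv_waveSq_sq : Summable fun K : Wave => (waveSq K ^ 2)⁻¹ := by
  let b := Pi.basisFun ℝ (Fin 3)
  let Λ : Submodule ℤ (Fin 3 → ℝ) := Submodule.span ℤ (Set.range b)
  have hr : Module.finrank ℤ Λ < 4 := by
    rw [ZLattice.rank ℝ Λ]; simp
  have hs := ZLattice.summable_norm_pow_inv Λ 4 hr
  let e : Wave → Λ := fun K => ⟨fun j => (K j : ℝ), by
    rw [Module.Basis.mem_span_iff_repr_mem]
    intro i; exact ⟨K i, by simp [b]⟩⟩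
  have he : Function.Injective e := by
    intro K K' h
    ext j
    have h' : (K j : ℝ) = K' j := congrFun (congrArg Subtype.val h) j
    exact_mod_cast h'
  refine Summable.of_nonneg_of_le (fun K => by positivity) (fun K => ?_) (hs.comp_injective he)
  by_cases hK : K = 0
  · subst hK; simp
  have hpos : 0 < ‖e K‖ := by
    rw [norm_pos_iff]
    intro h
    apply hK
    apply he
    rw [h]; ext j; simp [e]
  have hle : ‖e K‖ ^ 2 ≤ waveSq K := by
    have h1 : ‖e K‖ ≤ Real.sqrt (waveSq K) := by
      change ‖fun j => (K j : ℝ)‖ ≤ _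
      rw [pi_norm_le_iff_of_nonneg (Real.sqrt_nonneg _)]
      intro j
      rw [Real.norm_eq_abs, ← Real.sqrt_sq_eq_abs]
      exact Real.sqrt_le_sqrt (Finset.single_le_sum (f := fun j => (K j : ℝ) ^ 2)
        (fun _ _ => sq_nonneg _) (Finset.mem_univ j))
    calc ‖e K‖ ^ 2 ≤ Real.sqrt (waveSq K) ^ 2 := by gcongr
      _ = _ := Real.sq_sqrt (waveSq_nonneg K)
  simp only [Function.comp_apply, inv_pow]
  rw [show ‖e K‖ ^ 4 = (‖e K‖ ^ 2) ^ 2 by ring]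
  gcongr

/-! ### Sobolev sums and absolutely convergent Fourier series. -/

/-- `∑_K |K|^{2s} |û_K|²`. -/
def waveSum (s : ℕ) (u : Field) : ℝ := ∑' K : Wave, waveSq K ^ s * ‖u K‖ ^ 2

lemma waveSum_nonneg (s : ℕ) (u : Field) : 0 ≤ waveSum s u :=
  tsum_nonneg fun K => mul_nonneg (pow_nonneg (waveSq_nonneg K) _) (sq_nonneg _)

lemma normSq_eq (L : ℝ) (s : ℕ) (u : Field) :
    normSq L s u = L ^ 3 * (lam1 L ^ s * waveSum s u) := by
  simp [normSq, waveSum, eig, mul_pow, mul_assoc, tsum_mul_left]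

lemma normSq_nonneg {L : ℝ} (hL : 0 < L) (s : ℕ) (u : Field) : 0 ≤ normSq L s u := by
  rw [normSq_eq]
  have := lam1_pos hL
  have := waveSum_nonneg s u
  positivity

namespace MemV

variable {s : ℕ} {u : Field}

lemma mono {r : ℕ} (h : MemV s u) (hrs : r ≤ s) : MemV r u where
  mean_zero := h.mean_zero
  real := h.real
  div_free := h.div_free
  summable := by
    refine Summable.of_nonneg_of_le
      (fun K => mul_nonneg (pow_nonneg (waveSq_nonneg K) _) (sq_nonneg _)) (fun K => ?_) h.summable
    by_cases hK : K = 0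
    · subst hK; simp [h.mean_zero]
    · gcongr; exact one_le_waveSq hK

lemma waveSum_mono {r : ℕ} (h : MemV s u) (hrs : r ≤ s) : waveSum r u ≤ waveSum s u := by
  refine (h.mono hrs).summable.tsum_le_tsum (fun K => ?_) h.summable
  by_cases hK : K = 0
  · subst hK; simp [h.mean_zero]
  · gcongr; exact one_le_waveSq hK

lemma summable_sq (h : MemV s u) : Summable fun K => ‖u K‖ ^ 2 := by
  simpa using (h.mono (Nat.zero_le s)).summable

/-- The arithmetic-geometric mean inequality for `|K|⁻²` and `|K|²|û_K|`. It makes Fourier series of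
fields in `D(A)` absolutely convergent in dimension three. -/
lemma norm_le (h : MemV 2 u) (K : Wave) :
    ‖u K‖ ≤ ((waveSq K ^ 2)⁻¹ + waveSq K ^ 2 * ‖u K‖ ^ 2) / 2 := by
  by_cases hK : K = 0
  · subst hK; simp [h.mean_zero]
  have h1 : 0 < waveSq K := zero_lt_one.trans_le (one_le_waveSq hK)
  have : (waveSq K ^ 2)⁻¹ + waveSq K ^ 2 * ‖u K‖ ^ 2 - 2 * ‖u K‖
      = ((waveSq K)⁻¹ - waveSq K * ‖u K‖) ^ 2 := by field_simp; ring
  nlinarith [sq_nonneg ((waveSq K)⁻¹ - waveSq K * ‖u K‖)]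

lemma summable_norm (h : MemV 2 u) : Summable fun K => ‖u K‖ :=
  Summable.of_nonneg_of_le (fun _ => norm_nonneg _) h.norm_le
    ((summable_inv_waveSq_sq.add h.summable).div_const 2)

lemma tsum_norm_le (h : MemV 2 u) :
    ∑' K, ‖u K‖ ≤ ((∑' K : Wave, (waveSq K ^ 2)⁻¹) + waveSum 2 u) / 2 := by
  rw [waveSum, ← summable_inv_waveSq_sq.tsum_add h.summable, ← tsum_div_const]
  exact h.summable_norm.tsum_le_tsum h.norm_le
    ((summable_inv_waveSq_sq.add h.summable).div_const 2)

lemma inner_neg (h : MemV s u) (K J : Wave) :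
    inner ℂ (u (-K)) (u J) = inner ℂ (u (-J)) (u K) := by
  simp only [PiLp.inner_apply, RCLike.inner_apply]
  refine Finset.sum_congr rfl fun j _ => ?_
  rw [h.real K j, h.real J j, mul_comm]
  rfl

end MemV

/-! ### Triads and the cancellation of the nonlinear term. -/

/-- The contribution of the triad `(K, J, K - J)` to `⟨(u·∇)u, u⟩`. -/
def triad (u : Field) (p : Wave × Wave) : ℂ :=
  dotWave (u p.2) (p.1 - p.2) * inner ℂ (u p.1) (u (p.1 - p.2))

/-- `(K, J) ↦ (J - K, J)`, under which the triads are antisymmetric. -/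
def triadFlip : Wave × Wave ≃ Wave × Wave where
  toFun p := (p.2 - p.1, p.2)
  invFun p := (p.2 - p.1, p.2)
  left_inv p := by simp
  right_inv p := by simp

/-- `(K, J) ↦ (K - J, J)`. -/
def triadShift : Wave × Wave ≃ Wave × Wave where
  toFun p := (p.1 - p.2, p.2)
  invFun p := (p.1 + p.2, p.2)
  left_inv p := by simp
  right_inv p := by simp

/-- `|I|² |û_I|² |û_J|`. -/
def gradMajorant (u : Field) (p : Wave × Wave) : ℝ := waveSq p.1 ^ 1 * ‖u p.1‖ ^ 2 * ‖u p.2‖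

/-- `|û_I|² |û_J|`. -/
def massMajorant (u : Field) (p : Wave × Wave) : ℝ := ‖u p.1‖ ^ 2 * ‖u p.2‖

namespace MemV

variable {s : ℕ} {u : Field}

/-- Reality exchanges the two factors of the inner product, and `û_J · J = 0` turns `û_J · (-K)`
into `-û_J · (K - J)`. -/
lemma triad_flip (h : MemV s u) (p : Wave × Wave) : triad u (triadFlip p) = -triad u p := by
  obtain ⟨K, J⟩ := p
  have h1 : J - K - J = -K := by abel
  have h2 : J - K = -(K - J) := by abel
  simp only [triad, triadFlip, Equiv.coe_fn_mk, h1]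
  rw [h2, h.inner_neg (K - J) (-K), neg_neg, dotWave_sub, h.div_free]
  have : dotWave (u J) (-K) = -dotWave (u J) K := by simp [dotWave]
  rw [this]; ring

/-- Young's inequality puts the derivative entirely on `û_{K-J}` and leaves `|û_J|` to the first
power, so each majorant sums to an `ℓ²`-type sum times the `ℓ¹` norm. -/
lemma norm_triad_le (p : Wave × Wave) :
    ‖triad u p‖ ≤ (gradMajorant u (triadShift p) + massMajorant u p) / 2 := by
  obtain ⟨K, J⟩ := p
  simp only [triad, triadShift, gradMajorant, massMajorant, Equiv.coe_fn_mk, norm_mul, pow_one]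
  have h1 := norm_dotWave_le (u J) (K - J)
  have h2 := norm_inner_le_norm (𝕜 := ℂ) (u K) (u (K - J))
  have h3 := Real.sq_sqrt (waveSq_nonneg (K - J))
  have h0 := Real.sqrt_nonneg (waveSq (K - J))
  set q := Real.sqrt (waveSq (K - J))
  calc _ ≤ (‖u J‖ * q) * (‖u K‖ * ‖u (K - J)‖) := by gcongr
    _ ≤ _ := by
      rw [← h3]
      nlinarith [mul_nonneg (norm_nonneg (u J)) (sq_nonneg (q * ‖u (K - J)‖ - ‖u K‖))]

lemma summable_gradMajorant (h : MemV 2 u) : Summable (gradMajorant u) :=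
  (h.mono one_le_two).summable.mul_of_nonneg h.summable_norm
    (fun K => mul_nonneg (pow_nonneg (waveSq_nonneg K) _) (sq_nonneg _)) (fun _ => norm_nonneg _)

lemma summable_massMajorant (h : MemV 2 u) : Summable (massMajorant u) :=
  h.summable_sq.mul_of_nonneg h.summable_norm (fun _ => sq_nonneg _) (fun _ => norm_nonneg _)

lemma summable_gradMajorant_shift (h : MemV 2 u) :
    Summable fun p => gradMajorant u (triadShift p) :=
  triadShift.summable_iff.mpr h.summable_gradMajorant

lemma summable_norm_triad (h : MemV 2 u) : Summable fun p => ‖triad u p‖ :=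
  Summable.of_nonneg_of_le (fun _ => norm_nonneg _) norm_triad_le
    ((h.summable_gradMajorant_shift.add h.summable_massMajorant).div_const 2)

lemma tsum_gradMajorant (h : MemV 2 u) :
    ∑' p, gradMajorant u p = waveSum 1 u * ∑' K, ‖u K‖ :=
  ((h.mono one_le_two).summable.tsum_mul_tsum h.summable_norm h.summable_gradMajorant).symm

lemma tsum_massMajorant (h : MemV 2 u) :
    ∑' p, massMajorant u p = waveSum 0 u * ∑' K, ‖u K‖ := by
  have h0 : waveSum 0 u = ∑' K, ‖u K‖ ^ 2 := by simp [waveSum]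
  rw [h0]
  exact (h.summable_sq.tsum_mul_tsum h.summable_norm h.summable_massMajorant).symm

lemma tsum_norm_triad_le (h : MemV 2 u) :
    ∑' p, ‖triad u p‖ ≤ waveSum 1 u *
      (((∑' K : Wave, (waveSq K ^ 2)⁻¹) + waveSum 2 u) / 2) := by
  have hg := h.summable_gradMajorant_shift
  have hm := h.summable_massMajorant
  calc ∑' p, ‖triad u p‖ ≤ ∑' p, (gradMajorant u (triadShift p) + massMajorant u p) / 2 :=
        h.summable_norm_triad.tsum_le_tsum norm_triad_le ((hg.add hm).div_const 2)
    _ = (waveSum 1 u * ∑' K, ‖u K‖ + waveSum 0 u * ∑' K, ‖u K‖) / 2 := by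
        rw [tsum_div_const, hg.tsum_add hm, triadShift.tsum_eq (gradMajorant u),
          h.tsum_gradMajorant, h.tsum_massMajorant]
    _ ≤ waveSum 1 u * ∑' K, ‖u K‖ := by
        have h01 := (h.mono one_le_two).waveSum_mono (r := 0) (Nat.zero_le 1)
        have h1 : 0 ≤ ∑' K, ‖u K‖ := tsum_nonneg fun _ => norm_nonneg _
        nlinarith [mul_le_mul_of_nonneg_right h01 h1]
    _ ≤ _ := by
        gcongr
        · exact waveSum_nonneg _ _
        · exact h.tsum_norm_le

lemma tsum_triad (h : MemV 2 u) : ∑' p, triad u p = 0 := by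
  have h1 : ∑' p, triad u p = -∑' p, triad u p := by
    rw [← tsum_neg]
    conv_lhs => rw [← triadFlip.tsum_eq (triad u)]
    exact tsum_congr h.triad_flip
  exact self_eq_neg.mp h1

/-- The Leray projection subtracts a multiple of `K`, which is orthogonal to `û_K` because `u` is
divergence-free. -/
lemma inner_leray (h : MemV s u) (v : Field) (K : Wave) :
    inner ℂ (u K) (leray v K) = inner ℂ (u K) (v K) := by
  by_cases hK : K = 0
  · subst hK; simp [h.mean_zero]
  have h1 : inner ℂ (u K) (WithLp.toLp 2 (fun j => (K j : ℂ))) = star (dotWave (u K) K) := by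
    simp only [PiLp.inner_apply, RCLike.inner_apply, dotWave, star_sum, star_mul]
    refine Finset.sum_congr rfl fun j _ => ?_
    congr 1
    simp
  simp only [leray, hK, if_false, inner_sub_right, inner_smul_right, h1, h.div_free]
  simp

lemma summable_advect (h : MemV 1 u) (L : ℝ) (K : Wave) : Summable fun J : Wave =>
    (2 * Real.pi * Complex.I / L * dotWave (u J) (K - J)) • u (K - J) := by
  have h1 : Summable fun J => waveSq (K - J) ^ 1 * ‖u (K - J)‖ ^ 2 :=
    (Equiv.subLeft K).summable_iff.mpr h.summable
  refine Summable.of_norm_bounded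
    ((h.summable_sq.add h1).mul_left (‖2 * Real.pi * Complex.I / (L : ℂ)‖ / 2)) fun J => ?_
  rw [norm_smul, norm_mul]
  have h2 := norm_dotWave_le (u J) (K - J)
  have h3 := Real.sq_sqrt (waveSq_nonneg (K - J))
  set q := Real.sqrt (waveSq (K - J))
  calc _ ≤ ‖2 * Real.pi * Complex.I / (L : ℂ)‖ * (‖u J‖ * q) * ‖u (K - J)‖ := by gcongr
    _ ≤ _ := by
      rw [pow_one, ← h3]
      nlinarith [mul_nonneg (norm_nonneg (2 * Real.pi * Complex.I / (L : ℂ)))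
        (sq_nonneg (‖u J‖ - q * ‖u (K - J)‖))]

lemma inner_bilin (h : MemV 1 u) (L : ℝ) (K : Wave) :
    inner ℂ (u K) (bilin L u u K) =
      2 * Real.pi * Complex.I / L * ∑' J, triad u (K, J) := by
  rw [bilin, h.inner_leray, advect, ← innerSL_apply_apply,
    (innerSL ℂ (u K)).map_tsum (h.summable_advect L K), ← tsum_mul_left]
  refine tsum_congr fun J => ?_
  simp only [innerSL_apply_apply, inner_smul_right, triad]
  ring

/-- `⟨B(u,u), u⟩ = 0` for `u ∈ D(A)`. -/
lemma hasSum_inner_bilin (h : MemV 2 u) (L : ℝ) :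
    HasSum (fun K => inner ℂ (u K) (bilin L u u K)) 0 := by
  have h1 := h.summable_norm_triad.of_norm.hasSum
  have h2 := (h1.prod_fiberwise fun K =>
    (h.summable_norm_triad.of_norm.prod_factor K).hasSum).mul_left (2 * Real.pi * Complex.I / (L : ℂ))
  rw [h.tsum_triad, mul_zero] at h2
  simpa only [(h.mono one_le_two).inner_bilin L] using h2

/-- The bound is uniform in `S` and linear in `waveSum 2 u`, so it can serve as a dominating
function in time. -/
lemma norm_sum_inner_bilin_le (h : MemV 2 u) (L : ℝ) (S : Finset Wave) :
    ‖∑ K ∈ S, inner ℂ (u K) (bilin L u u K)‖ ≤ ‖2 * Real.pi * Complex.I / (L : ℂ)‖ *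
      (waveSum 1 u * (((∑' K : Wave, (waveSq K ^ 2)⁻¹) + waveSum 2 u) / 2)) := by
  have hs := h.summable_norm_triad
  calc _ ≤ ∑ K ∈ S, ‖2 * Real.pi * Complex.I / (L : ℂ)‖ * ∑' J, ‖triad u (K, J)‖ := by
        refine (norm_sum_le _ _).trans (Finset.sum_le_sum fun K _ => ?_)
        rw [(h.mono one_le_two).inner_bilin L, norm_mul]
        gcongr
        exact norm_tsum_le_tsum_norm (hs.prod_factor K)
    _ ≤ ‖2 * Real.pi * Complex.I / (L : ℂ)‖ * ∑' p, ‖triad u p‖ := by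
        rw [← Finset.mul_sum]
        gcongr
        rw [hs.tsum_prod]
        exact hs.prod.sum_le_tsum S fun K _ => tsum_nonneg fun _ => norm_nonneg _
    _ ≤ _ := by
        gcongr
        exact h.tsum_norm_triad_le

end MemV

/-! ### Weighted product rule for primitives of integrable functions. -/

/-- The product rule for `e^{γt} y²` when `y` is the primitive of an integrable function. -/
lemma integral_exp_mul_sq {y g : ℝ → ℝ} {a b γ : ℝ} (hab : a ≤ b)
    (hg : IntervalIntegrable g volume a b)
    (hy : ∀ t ∈ Icc a b, y t - y a = ∫ s in a..t, g s) :
    IntervalIntegrable (fun s => Real.exp (γ * s) * (γ * y s ^ 2 + 2 * (y s * g s))) volume a b ∧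
    ∫ s in a..b, Real.exp (γ * s) * (γ * y s ^ 2 + 2 * (y s * g s)) =
      Real.exp (γ * b) * y b ^ 2 - Real.exp (γ * a) * y a ^ 2 := by
  -- `y` is controlled only on `[a, b]`; its primitive form `P` is defined everywhere and is the
  -- function to differentiate.
  let P : ℝ → ℝ := fun t => y a + ∫ s in a..t, g s
  have hP : ∀ t ∈ Icc a b, P t = y t := fun t ht => by simp [P, ← hy t ht]
  have hPac : AbsolutelyContinuousOnInterval P a b :=
    ((contDiff_const (c := y a)).contDiffOn (s := uIcc a b) (n := 1)).absolutelyContinuousOnInterval.add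
      (hg.absolutelyContinuousOnInterval_intervalIntegral left_mem_uIcc)
  have hEac : AbsolutelyContinuousOnInterval (fun t => Real.exp (γ * t)) a b :=
    ((Real.contDiff_exp.comp (contDiff_const.mul contDiff_id)).contDiffOn
      (n := 1)).absolutelyContinuousOnInterval
  have hac := hEac.mul (hPac.mul hPac)
  have hae : ∀ᵐ x, x ∈ uIoc a b →
      deriv ((fun t => Real.exp (γ * t)) * (P * P)) x =
        Real.exp (γ * x) * (γ * y x ^ 2 + 2 * (y x * g x)) := by
    filter_upwards [hg.ae_hasDerivAt_integral] with x hx hxI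
    have hxI' : x ∈ Icc a b := uIcc_of_le hab ▸ uIoc_subset_uIcc hxI
    have hPd : HasDerivAt P (g x) x :=
      (hx (uIoc_subset_uIcc hxI) a left_mem_uIcc).const_add (y a)
    have hE : HasDerivAt (fun t => Real.exp (γ * t)) (Real.exp (γ * x) * γ) x := by
      simpa using ((hasDerivAt_id x).const_mul γ).exp
    rw [(hE.mul (hPd.mul hPd)).deriv]
    simp only [Pi.mul_apply, hP x hxI']
    ring
  constructor
  · exact hac.intervalIntegrable_deriv.congr_ae ((ae_restrict_iff' measurableSet_uIoc).mpr hae)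
  · rw [← intervalIntegral.integral_congr_ae hae, hac.integral_deriv_eq_sub]
    simp only [Pi.mul_apply, hP a (left_mem_Icc.mpr hab), hP b (right_mem_Icc.mpr hab)]
    ring

/-- Apply the scalar rule to the coordinates in an orthonormal basis and add. -/
lemma integral_exp_mul_normSq {E : Type*} [NormedAddCommGroup E] [InnerProductSpace ℝ E]
    [FiniteDimensional ℝ E] {y g : ℝ → E} {a b γ : ℝ} (hab : a ≤ b)
    (hg : IntervalIntegrable g volume a b)
    (hy : ∀ t ∈ Icc a b, y t - y a = ∫ s in a..t, g s) :
    IntervalIntegrable (fun s => Real.exp (γ * s) * (γ * ‖y s‖ ^ 2 + 2 * inner ℝ (y s) (g s)))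
      volume a b ∧
    ∫ s in a..b, Real.exp (γ * s) * (γ * ‖y s‖ ^ 2 + 2 * inner ℝ (y s) (g s)) =
      Real.exp (γ * b) * ‖y b‖ ^ 2 - Real.exp (γ * a) * ‖y a‖ ^ 2 := by
  let β := stdOrthonormalBasis ℝ E
  have hcomp := fun i => integral_exp_mul_sq (γ := γ) (y := fun t => inner ℝ (β i) (y t))
    (g := fun t => inner ℝ (β i) (g t)) hab
    ⟨(innerSL ℝ (β i)).integrable_comp hg.1, (innerSL ℝ (β i)).integrable_comp hg.2⟩ (fun t ht => by
      have hgt : IntervalIntegrable g volume a t := hg.mono_set (by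
        rw [uIcc_of_le hab, uIcc_of_le ht.1]; exact Icc_subset_Icc_right ht.2)
      rw [← inner_sub_right, hy t ht]
      exact ((innerSL ℝ (β i)).intervalIntegral_comp_comm hgt).symm)
  have hnorm : ∀ x : E, ‖x‖ ^ 2 = ∑ i, inner ℝ (β i) x ^ 2 := fun x => by
    rw [← β.sum_sq_norm_inner_right x]; simp
  have hinner : ∀ x z : E, inner ℝ x z = ∑ i, inner ℝ (β i) x * inner ℝ (β i) z := fun x z => by
    rw [← β.sum_inner_mul_inner x z]
    exact Finset.sum_congr rfl fun i _ => by rw [real_inner_comm]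
  have hsum : (fun s => Real.exp (γ * s) * (γ * ‖y s‖ ^ 2 + 2 * inner ℝ (y s) (g s))) = fun s =>
      ∑ i, Real.exp (γ * s) * (γ * inner ℝ (β i) (y s) ^ 2 +
        2 * (inner ℝ (β i) (y s) * inner ℝ (β i) (g s))) := by
    funext s
    rw [hnorm, hinner, ← Finset.mul_sum, Finset.sum_add_distrib, Finset.mul_sum, Finset.mul_sum]
  rw [hsum]
  constructor
  · have := IntervalIntegrable.sum Finset.univ fun i _ => (hcomp i).1
    simpa only [Finset.sum_fn] using this
  · rw [intervalIntegral.integral_finsetSum fun i _ => (hcomp i).1]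
    simp_rw [fun i => (hcomp i).2]
    rw [Finset.sum_sub_distrib, ← Finset.mul_sum, ← Finset.mul_sum, ← hnorm, ← hnorm]

/-! ### The Helmholtz symbol and the energy. -/

lemma re_inner_eq (x y : EuclideanSpace ℂ (Fin 3)) :
    inner ℝ x y = (inner ℂ x y).re := by
  simp [PiLp.inner_apply, Complex.inner]

/-- The symbol `1 + a² (2π|K|/L)²` of the Helmholtz operator `I + a² A`. -/
def helmSymbol (L a : ℝ) (K : Wave) : ℝ := 1 + a ^ 2 * eig L K

lemma helmSymbol_pos {L : ℝ} (hL : 0 < L) (a : ℝ) (K : Wave) : 0 < helmSymbol L a K := by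
  have := eig_nonneg hL K
  unfold helmSymbol; positivity

lemma helmholtz_apply (L a : ℝ) (u : Field) (K : Wave) :
    helmholtz L a u K = helmSymbol L a K • u K := by
  simp only [helmholtz, stokes, helmSymbol, Pi.add_apply, Pi.smul_apply, add_smul, one_smul,
    mul_smul]
  rfl

lemma stokes_apply (L : ℝ) (u : Field) (K : Wave) : stokes L u K = eig L K • u K := rfl

/-- `L⁻³ (‖u‖² + a² ‖∇u‖²)`. -/
def energy (L a : ℝ) (u : Field) : ℝ := waveSum 0 u + a ^ 2 * (lam1 L * waveSum 1 u)

lemma normSq_add_normSq (L a : ℝ) (u : Field) :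
    normSq L 0 u + a ^ 2 * normSq L 1 u = L ^ 3 * energy L a u := by
  rw [normSq_eq, normSq_eq, energy]; ring

lemma MemV.hasSum_energy {u : Field} (h : MemV 1 u) (L a : ℝ) :
    HasSum (fun K => helmSymbol L a K * ‖u K‖ ^ 2) (energy L a u) := by
  have h0 := (h.mono (Nat.zero_le 1)).summable.hasSum
  have h1 := (h.summable.hasSum.mul_left (lam1 L)).mul_left (a ^ 2)
  refine (h0.add h1).congr_fun ?_
  intro K
  simp only [helmSymbol, eig]
  ring

lemma waveSum_le_two_mul {u v : Field} {s : ℕ} (hu : MemV s u) (hv : MemV s v) :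
    waveSum s v ≤ 2 * waveSum s (v - u) + 2 * waveSum s u := by
  have hle : ∀ x y : EuclideanSpace ℂ (Fin 3), ‖x‖ ^ 2 ≤ 2 * ‖x - y‖ ^ 2 + 2 * ‖y‖ ^ 2 := by
    intro x y
    have h1 : ‖x‖ ≤ ‖x - y‖ + ‖y‖ := by simpa using norm_add_le (x - y) y
    nlinarith [sq_nonneg (‖x - y‖ - ‖y‖), norm_nonneg x, norm_nonneg y, norm_nonneg (x - y)]
  have hle' : ∀ x y : EuclideanSpace ℂ (Fin 3), ‖x - y‖ ^ 2 ≤ 2 * ‖x‖ ^ 2 + 2 * ‖y‖ ^ 2 := by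
    intro x y
    have h1 := norm_sub_le x y
    nlinarith [sq_nonneg (‖x‖ - ‖y‖), norm_nonneg x, norm_nonneg y, norm_nonneg (x - y)]
  -- Without this, the sum for `v - u` could be the default value `0` and the bound would be false.
  have hd : Summable fun K => waveSq K ^ s * ‖(v - u) K‖ ^ 2 := by
    refine Summable.of_nonneg_of_le
      (fun K => mul_nonneg (pow_nonneg (waveSq_nonneg K) _) (sq_nonneg _)) (fun K => ?_)
      ((hv.summable.mul_left 2).add (hu.summable.mul_left 2))
    have := mul_le_mul_of_nonneg_left (hle' (v K) (u K)) (pow_nonneg (waveSq_nonneg K) s)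
    calc _ ≤ _ := this
      _ = _ := by ring
  unfold waveSum
  rw [← tsum_mul_left, ← tsum_mul_left, ← (hd.mul_left 2).tsum_add (hu.summable.mul_left 2)]
  refine hv.summable.tsum_le_tsum (fun K => ?_) ((hd.mul_left 2).add (hu.summable.mul_left 2))
  have := mul_le_mul_of_nonneg_left (hle (v K) (u K)) (pow_nonneg (waveSq_nonneg K) s)
  calc _ ≤ _ := this
    _ = _ := by simp only [Pi.sub_apply]; ring

/-! ### The energy inequality for a general forcing. -/

namespace IsSolution

variable {L ν a : ℝ} {F w : ℝ → Field} {I : Set ℝ}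

lemma mono {J : Set ℝ} (h : IsSolution L ν a F I w) (hJ : J ⊆ I) : IsSolution L ν a F J w where
  mem_V t ht := h.mem_V t (hJ ht)
  continuous_V t ht := (h.continuous_V t (hJ ht)).mono_left (nhdsWithin_mono _ hJ)
  mem_DA := ae_restrict_of_ae_restrict_of_subset hJ h.mem_DA
  sq_integrable_DA t₀ h₀ t₁ h₁ := h.sq_integrable_DA t₀ (hJ h₀) t₁ (hJ h₁)
  integrable K t₀ h₀ t₁ h₁ := h.integrable K t₀ (hJ h₀) t₁ (hJ h₁)
  equation K t₀ h₀ t₁ h₁ := h.equation K t₀ (hJ h₀) t₁ (hJ h₁)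

/-- Continuity into `V` bounds the sum near each time, and compactness makes the bound uniform. -/
lemma exists_waveSum_le (h : IsSolution L ν a F I w) (hL : 0 < L) (hI : IsCompact I) :
    ∃ M, ∀ t ∈ I, waveSum 1 (w t) ≤ M := by
  have key : ∃ M, ∀ t ∈ I, t ∈ I → waveSum 1 (w t) ≤ M := by
    refine hI.induction_on (p := fun s => ∃ M, ∀ t ∈ s, t ∈ I → waveSum 1 (w t) ≤ M)
      ⟨0, by simp⟩ ?_ ?_ ?_
    · rintro s s' hs ⟨M, hM⟩
      exact ⟨M, fun t ht => hM t (hs ht)⟩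
    · rintro s s' ⟨M, hM⟩ ⟨M', hM'⟩
      refine ⟨max M M', fun t ht htI => ?_⟩
      rcases ht with ht | ht
      · exact (hM t ht htI).trans (le_max_left _ _)
      · exact (hM' t ht htI).trans (le_max_right _ _)
    · intro x hx
      have hpos : 0 < L ^ 3 * lam1 L := mul_pos (pow_pos hL 3) (lam1_pos hL)
      refine ⟨_, (h.continuous_V x hx).eventually (gt_mem_nhds hpos),
        2 * 1 + 2 * waveSum 1 (w x), fun t ht htI => ?_⟩
      have h1 := waveSum_le_two_mul (h.mem_V x hx) (h.mem_V t htI)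
      have h2 : normSq L 1 (w t - w x) < L ^ 3 * lam1 L := ht
      rw [normSq_eq, pow_one, ← mul_assoc] at h2
      have h3 : waveSum 1 (w t - w x) < 1 := by
        by_contra hcon
        exact absurd h2 (not_lt.mpr (le_mul_of_one_le_right hpos.le (not_lt.mp hcon)))
      linarith
  exact key.imp fun M hM t ht => hM t ht ht

variable {T₀ T₁ γ : ℝ}

/-- The right-hand side of the equation of the mode `K`. -/
def modeRhs (L ν a : ℝ) (F w : ℝ → Field) (K : Wave) (s : ℝ) : EuclideanSpace ℂ (Fin 3) :=
  F s K - (ν : ℂ) • stokes L (helmholtz L a (w s)) K - bilin L (w s) (w s) K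

lemma inner_modeRhs (K : Wave) (s : ℝ) :
    inner ℝ (w s K) (modeRhs L ν a F w K s) =
      inner ℝ (w s K) (F s K) - ν * eig L K * helmSymbol L a K * ‖w s K‖ ^ 2 -
        (inner ℂ (w s K) (bilin L (w s) (w s) K)).re := by
  have h1 : (ν : ℂ) • stokes L (helmholtz L a (w s)) K
      = (ν * eig L K * helmSymbol L a K) • w s K := by
    rw [stokes_apply, helmholtz_apply, mul_smul, mul_smul]; rfl
  rw [modeRhs, h1, inner_sub_right, inner_sub_right, real_inner_smul_right,
    real_inner_self_eq_norm_sq, re_inner_eq (w s K) (bilin L (w s) (w s) K)]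

lemma mode_sub (h : IsSolution L ν a F (Icc T₀ T₁) w) (hL : 0 < L) (K : Wave) {t : ℝ}
    (ht : t ∈ Icc T₀ T₁) :
    w t K - w T₀ K = ∫ s in T₀..t, (helmSymbol L a K)⁻¹ • modeRhs L ν a F w K s := by
  have hm := (helmSymbol_pos hL a K).ne'
  have h0 : T₀ ∈ Icc T₀ T₁ := ⟨le_rfl, ht.1.trans ht.2⟩
  have := h.equation K T₀ h0 t ht
  rw [helmholtz_apply, helmholtz_apply, ← smul_sub] at this
  rw [intervalIntegral.integral_smul]
  change _ = (helmSymbol L a K)⁻¹ •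
    ∫ s in T₀..t, (F s K - (ν : ℂ) • stokes L (helmholtz L a (w s)) K - bilin L (w s) (w s) K)
  rw [← this, smul_smul, inv_mul_cancel₀ hm, one_smul]

lemma intervalIntegrable_modeRhs (h : IsSolution L ν a F (Icc T₀ T₁) w) (K : Wave) {t : ℝ}
    (ht : t ∈ Icc T₀ T₁) : IntervalIntegrable (modeRhs L ν a F w K) volume T₀ t :=
  h.integrable K T₀ ⟨le_rfl, ht.1.trans ht.2⟩ t ht

lemma continuousOn_mode (h : IsSolution L ν a F (Icc T₀ T₁) w) (hL : 0 < L) (K : Wave)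
    (hT : T₀ ≤ T₁) : ContinuousOn (fun t => w t K) (Icc T₀ T₁) := by
  have h1 := intervalIntegral.continuousOn_primitive_interval'
    ((h.intervalIntegrable_modeRhs K (right_mem_Icc.mpr hT)).smul (helmSymbol L a K)⁻¹)
    (left_mem_uIcc (a := T₀) (b := T₁))
  rw [uIcc_of_le hT] at h1
  refine (h1.const_add (w T₀ K)).congr fun t ht => ?_
  have := h.mode_sub hL K ht
  simp only [Pi.smul_apply]
  rw [← this]; abel

/-- Measurability is read off the equation: the nonlinear work is what remains after the forcing,
the dissipation and the integrable right-hand side, so the convolution need not be examined. -/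
lemma aestronglyMeasurable_bilin (h : IsSolution L ν a F (Icc T₀ T₁) w) (hL : 0 < L)
    (hF : ∀ K, AEStronglyMeasurable (fun s => F s K) (volume.restrict (Icc T₀ T₁))) (K : Wave)
    {t : ℝ} (ht : t ∈ Icc T₀ T₁) :
    AEStronglyMeasurable (fun s => (inner ℂ (w s K) (bilin L (w s) (w s) K)).re)
      (volume.restrict (uIoc T₀ t)) := by
  have hsub : uIoc T₀ t ⊆ Icc T₀ T₁ := by
    rw [uIoc_of_le ht.1]
    exact Ioc_subset_Icc_self.trans (Icc_subset_Icc_right ht.2)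
  have hw : AEStronglyMeasurable (fun s => w s K) (volume.restrict (uIoc T₀ t)) :=
    ((h.continuousOn_mode hL K (ht.1.trans ht.2)).mono hsub).aestronglyMeasurable
      measurableSet_uIoc
  have hF' := (hF K).mono_measure (Measure.restrict_mono hsub le_rfl)
  have hG : AEStronglyMeasurable (modeRhs L ν a F w K) (volume.restrict (uIoc T₀ t)) :=
    (intervalIntegrable_iff.mp (h.intervalIntegrable_modeRhs K ht)).aestronglyMeasurable
  have heq : (fun s => (inner ℂ (w s K) (bilin L (w s) (w s) K)).re) = fun s =>
      inner ℝ (w s K) (F s K) - ν * eig L K * helmSymbol L a K * ‖w s K‖ ^ 2 -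
        inner ℝ (w s K) (modeRhs L ν a F w K s) := by
    funext s; rw [inner_modeRhs]; ring
  rw [heq]
  exact ((hw.inner hF').sub ((hw.norm.pow 2).const_mul _)).sub (hw.inner hG)

/-- The weighted energy identity of a single mode. -/
lemma mode_energy (h : IsSolution L ν a F (Icc T₀ T₁) w) (hL : 0 < L) (K : Wave) {t : ℝ}
    (ht : t ∈ Icc T₀ T₁) (γ : ℝ) :
    IntervalIntegrable (fun s => Real.exp (γ * s) *
      (2 * inner ℝ (w s K) (F s K) +
        (γ - 2 * ν * eig L K) * (helmSymbol L a K * ‖w s K‖ ^ 2) -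
        2 * (inner ℂ (w s K) (bilin L (w s) (w s) K)).re)) volume T₀ t ∧
    ∫ s in T₀..t, Real.exp (γ * s) *
      (2 * inner ℝ (w s K) (F s K) +
        (γ - 2 * ν * eig L K) * (helmSymbol L a K * ‖w s K‖ ^ 2) -
        2 * (inner ℂ (w s K) (bilin L (w s) (w s) K)).re) =
      Real.exp (γ * t) * (helmSymbol L a K * ‖w t K‖ ^ 2) -
        Real.exp (γ * T₀) * (helmSymbol L a K * ‖w T₀ K‖ ^ 2) := by
  have hm := (helmSymbol_pos hL a K).ne'
  obtain ⟨h1, h2⟩ := integral_exp_mul_normSq (γ := γ) (y := fun s => w s K) ht.1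
    ((h.intervalIntegrable_modeRhs K ht).smul (helmSymbol L a K)⁻¹)
    (fun s hs => h.mode_sub hL K ⟨hs.1, hs.2.trans ht.2⟩)
  have heq : (fun s => Real.exp (γ * s) *
      (2 * inner ℝ (w s K) (F s K) +
        (γ - 2 * ν * eig L K) * (helmSymbol L a K * ‖w s K‖ ^ 2) -
        2 * (inner ℂ (w s K) (bilin L (w s) (w s) K)).re)) = fun s =>
      helmSymbol L a K * (Real.exp (γ * s) * (γ * ‖w s K‖ ^ 2 +
        2 * inner ℝ (w s K) (((helmSymbol L a K)⁻¹ • modeRhs L ν a F w K) s))) := by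
    funext s
    rw [Pi.smul_apply, real_inner_smul_right, inner_modeRhs]
    field_simp
    ring
  rw [heq]
  refine ⟨h1.const_mul _, ?_⟩
  rw [intervalIntegral.integral_const_mul, h2]
  ring

/-- The energy inequality: a pointwise bound on the modes of the forcing and of the dissipation
gives exponential decay up to a constant, since the nonlinear term does no work. -/
theorem energy_le (h : IsSolution L ν a F (Icc T₀ T₁) w) (hL : 0 < L)
    (hF : ∀ K, AEStronglyMeasurable (fun s => F s K) (volume.restrict (Icc T₀ T₁)))
    {C : ℝ} (hγ : 0 < γ) (hC : 0 ≤ C)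
    (hbound : ∀ᵐ s ∂(volume.restrict (Icc T₀ T₁)), ∃ c : Wave → ℝ,
      (∀ K, 2 * inner ℝ (w s K) (F s K) +
        (γ - 2 * ν * eig L K) * (helmSymbol L a K * ‖w s K‖ ^ 2) ≤ c K) ∧
      ∀ S : Finset Wave, ∑ K ∈ S, c K ≤ C)
    {t : ℝ} (ht : t ∈ Icc T₀ T₁) :
    energy L a (w t) ≤ Real.exp (-(γ * (t - T₀))) * energy L a (w T₀) + C / γ := by
  have h0 : T₀ ∈ Icc T₀ T₁ := ⟨le_rfl, ht.1.trans ht.2⟩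
  have hsub : uIoc T₀ t ⊆ Icc T₀ T₁ := by
    rw [uIoc_of_le ht.1]
    exact Ioc_subset_Icc_self.trans (Icc_subset_Icc_right ht.2)
  have hcexp : Continuous fun s : ℝ => Real.exp (γ * s) := by fun_prop
  obtain ⟨M, hM⟩ := h.exists_waveSum_le hL isCompact_Icc
  set Z : ℝ := ∑' K : Wave, (waveSq K ^ 2)⁻¹
  set κ : ℝ := ‖2 * Real.pi * Complex.I / (L : ℂ)‖
  let b : Finset Wave → ℝ → ℝ := fun S s =>
    ∑ K ∈ S, (inner ℂ (w s K) (bilin L (w s) (w s) K)).re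
  let bd : ℝ → ℝ := fun s => Real.exp (γ * s) * (κ * (M * ((Z + waveSum 2 (w s)) / 2)))
  have hZ : 0 ≤ Z := tsum_nonneg fun K => by positivity
  have hDA : ∀ᵐ s ∂volume, s ∈ uIoc T₀ t → MemV 2 (w s) :=
    (ae_restrict_iff' measurableSet_uIoc).mp (ae_restrict_of_ae_restrict_of_subset hsub h.mem_DA)
  have hbd : IntervalIntegrable bd volume T₀ t := by
    have hsq : IntervalIntegrable (fun s => normSq L 2 (w s)) volume T₀ t :=
      (intervalIntegrable_iff_integrableOn_Icc_of_le ht.1).mpr (h.sq_integrable_DA T₀ h0 t ht)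
    have hws : IntervalIntegrable (fun s => waveSum 2 (w s)) volume T₀ t := by
      refine (hsq.const_mul (L ^ 3 * lam1 L ^ 2)⁻¹).congr_ae (ae_of_all _ fun s => ?_)
      have := lam1_pos hL
      simp only [normSq_eq]
      field_simp
    exact ((((intervalIntegrable_const.add hws).div_const 2).const_mul M).const_mul
      κ).continuousOn_mul hcexp.continuousOn
  have hbmeas : ∀ S, AEStronglyMeasurable (fun s => Real.exp (γ * s) * b S s)
      (volume.restrict (uIoc T₀ t)) := fun S =>
    hcexp.aestronglyMeasurable.mul
      (Finset.aestronglyMeasurable_fun_sum S fun K _ => h.aestronglyMeasurable_bilin hL hF K ht)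
  have hble : ∀ S, ∀ᵐ s ∂volume, s ∈ uIoc T₀ t → ‖Real.exp (γ * s) * b S s‖ ≤ bd s := by
    intro S
    filter_upwards [hDA] with s hs hst
    rw [norm_mul, Real.norm_of_nonneg (Real.exp_pos _).le]
    have h1 : ‖b S s‖ ≤ ‖∑ K ∈ S, inner ℂ (w s K) (bilin L (w s) (w s) K)‖ := by
      simp only [b, ← Complex.re_sum]
      exact Complex.abs_re_le_norm _
    have h2 := (hs hst).norm_sum_inner_bilin_le L S
    have h3 := hM s (hsub hst)
    have h4 := waveSum_nonneg 2 (w s)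
    have h5 : 0 ≤ κ := norm_nonneg _
    refine mul_le_mul_of_nonneg_left (h1.trans (h2.trans ?_)) (Real.exp_pos _).le
    gcongr
  have hbint : ∀ S, IntervalIntegrable (fun s => Real.exp (γ * s) * b S s) volume T₀ t :=
    fun S => hbd.mono_fun' (hbmeas S) ((ae_restrict_iff' measurableSet_uIoc).mpr (hble S))
  -- Dominated convergence along the finite sets of modes; the pointwise limit is the vanishing of
  -- `⟨B(w,w), w⟩` in `D(A)`.
  have hblim : Tendsto (fun S => ∫ s in T₀..t, Real.exp (γ * s) * b S s) atTop (𝓝 0) := by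
    have := intervalIntegral.tendsto_integral_filter_of_dominated_convergence
      (F := fun S s => Real.exp (γ * s) * b S s) (f := fun _ => (0 : ℝ)) (l := atTop) bd
      (Eventually.of_forall hbmeas) (Eventually.of_forall hble) hbd (by
        filter_upwards [hDA] with s hs hst
        have h1 := (Complex.continuous_re.tendsto 0).comp ((hs hst).hasSum_inner_bilin L)
        have h2 := (h1.const_mul (Real.exp (γ * s)))
        simpa [b, Function.comp_def] using h2)
    simpa using this
  have hfin : ∀ S : Finset Wave,
      Real.exp (γ * t) * (∑ K ∈ S, helmSymbol L a K * ‖w t K‖ ^ 2) -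
        Real.exp (γ * T₀) * (∑ K ∈ S, helmSymbol L a K * ‖w T₀ K‖ ^ 2) ≤
      C * (Real.exp (γ * t) / γ) - 2 * ∫ s in T₀..t, Real.exp (γ * s) * b S s := by
    intro S
    have hmode := fun K => h.mode_energy hL K ht γ
    have hexp : ∫ s in T₀..t, Real.exp (γ * s) = (Real.exp (γ * t) - Real.exp (γ * T₀)) / γ := by
      rw [intervalIntegral.integral_comp_mul_left Real.exp hγ.ne', integral_exp, smul_eq_mul]
      ring
    have hsumint := IntervalIntegrable.sum S fun K _ => (hmode K).1
    simp only [Finset.sum_fn] at hsumint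
    have hupint : IntervalIntegrable
        (fun s => C * Real.exp (γ * s) - 2 * (Real.exp (γ * s) * b S s)) volume T₀ t :=
      ((hcexp.intervalIntegrable _ _).const_mul C).sub ((hbint S).const_mul 2)
    rw [Finset.mul_sum, Finset.mul_sum, ← Finset.sum_sub_distrib,
      ← Finset.sum_congr rfl fun K _ => (hmode K).2,
      ← intervalIntegral.integral_finsetSum fun K _ => (hmode K).1]
    calc _ ≤ ∫ s in T₀..t, (C * Real.exp (γ * s) - 2 * (Real.exp (γ * s) * b S s)) := by
          refine intervalIntegral.integral_mono_ae_restrict ht.1 hsumint hupint ?_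
          have hb' := ae_restrict_of_ae_restrict_of_subset
            (Icc_subset_Icc_right ht.2 : Icc T₀ t ⊆ Icc T₀ T₁) hbound
          filter_upwards [hb'] with s hs
          -- Only the constant bounding the finite sums of `c` is integrated, so `c` need not be
          -- measurable in time.
          obtain ⟨c, hc, hcS⟩ := hs
          rw [← Finset.mul_sum, Finset.sum_sub_distrib, ← Finset.mul_sum]
          have h1 := (Finset.sum_le_sum fun K (_ : K ∈ S) => hc K).trans (hcS S)
          have h2 := mul_le_mul_of_nonneg_left h1 (Real.exp_pos (γ * s)).le
          simp only [b]
          linarith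
      _ = C * ((Real.exp (γ * t) - Real.exp (γ * T₀)) / γ) -
            2 * ∫ s in T₀..t, Real.exp (γ * s) * b S s := by
          rw [intervalIntegral.integral_sub ((hcexp.intervalIntegrable _ _).const_mul C)
            ((hbint S).const_mul 2), intervalIntegral.integral_const_mul,
            intervalIntegral.integral_const_mul, hexp]
      _ ≤ _ := by
          gcongr
          linarith [Real.exp_pos (γ * T₀)]
  have hlim := le_of_tendsto_of_tendsto'
    ((((h.mem_V t ht).hasSum_energy L a).const_mul (Real.exp (γ * t))).sub
      (((h.mem_V T₀ h0).hasSum_energy L a).const_mul (Real.exp (γ * T₀))))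
    ((hblim.const_mul 2).const_sub (C * (Real.exp (γ * t) / γ))) hfin
  rw [mul_zero, sub_zero] at hlim
  have he : Real.exp (γ * T₀) = Real.exp (γ * t) * Real.exp (-(γ * (t - T₀))) := by
    rw [← Real.exp_add]; congr 1; ring
  rw [he] at hlim
  refine le_of_mul_le_mul_left ?_ (Real.exp_pos (γ * t))
  calc _ ≤ _ := sub_le_iff_le_add.mp hlim
    _ = _ := by ring

end IsSolution

/-! ### Forcing bounds and the energy of the Bardina system. -/

lemma waveSum_zero_eq (u : Field) : waveSum 0 u = ∑' K, ‖u K‖ ^ 2 := by simp [waveSum]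

lemma MemLinfH.ae_waveSum_le {L : ℝ} {f : ℝ → Field} (hf : MemLinfH L f) (hL : 0 < L) :
    ∀ᵐ s ∂(volume.restrict (Ici (0 : ℝ))),
      MemV 0 (f s) ∧ waveSum 0 (f s) ≤ supNorm L f ^ 2 / L ^ 3 := by
  have hle : ∀ᵐ s ∂(volume.restrict (Ici (0 : ℝ))), ‖Real.sqrt (normSq L 0 (f s))‖ₑ ≤
      eLpNorm (fun t => Real.sqrt (normSq L 0 (f t))) ⊤ (volume.restrict (Ici 0)) := by
    rw [eLpNorm_exponent_top]
    exact ae_le_eLpNormEssSup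
  filter_upwards [hf.mem, hle] with s hs hle
  refine ⟨hs, ?_⟩
  have h1 : Real.sqrt (normSq L 0 (f s)) ≤ supNorm L f := by
    have := ENNReal.toReal_mono hf.bounded.2.ne hle
    rwa [toReal_enorm, Real.norm_of_nonneg (Real.sqrt_nonneg _)] at this
  have h2 : normSq L 0 (f s) ≤ supNorm L f ^ 2 := by
    rw [← Real.sq_sqrt (normSq_nonneg hL 0 (f s))]
    gcongr
  rw [normSq_eq, pow_zero, one_mul] at h2
  rw [le_div_iff₀ (by positivity)]
  linarith

/-- Young's inequality `2⟨x, y⟩ ≤ c|x|² + |y|²/c`. -/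
lemma two_mul_inner_le {E : Type*} [NormedAddCommGroup E] [InnerProductSpace ℝ E] (x y : E)
    {c : ℝ} (hc : 0 < c) : 2 * inner ℝ x y ≤ c * ‖x‖ ^ 2 + ‖y‖ ^ 2 / c := by
  have h1 := real_inner_le_norm x y
  have h2 : c * ‖x‖ ^ 2 + ‖y‖ ^ 2 / c - 2 * (‖x‖ * ‖y‖) = (c * ‖x‖ - ‖y‖) ^ 2 / c := by
    field_simp; ring
  have h3 : 0 ≤ (c * ‖x‖ - ‖y‖) ^ 2 / c := by positivity
  linarith

variable {L ν : ℝ}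

lemma one_le_helmSymbol (hL : 0 < L) (a : ℝ) (K : Wave) : 1 ≤ helmSymbol L a K := by
  have := eig_nonneg hL K
  have : 0 ≤ a ^ 2 * eig L K := by positivity
  unfold helmSymbol; linarith

lemma energy_nonneg (hL : 0 < L) (a : ℝ) (u : Field) : 0 ≤ energy L a u := by
  have := lam1_pos hL
  have := waveSum_nonneg 0 u
  have := waveSum_nonneg 1 u
  unfold energy; positivity

/-- The energy of a solution of the simplified Bardina system. -/
theorem IsBardinaSolution.energy_le {α : ℝ} {f u : ℝ → Field} (hu : IsBardinaSolution L ν α f u)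
    (hL : 0 < L) (hν : 0 < ν) (hf : MemLinfH L f) {s : ℝ} (hs : 0 ≤ s) :
    energy L α (u s) ≤ Real.exp (-(ν * lam1 L * s)) * energy L α (u 0) +
      1 / (lam1 L ^ 2 * ν ^ 2) * (supNorm L f ^ 2 / L ^ 3) := by
  have hlam := lam1_pos hL
  have hγ : 0 < ν * lam1 L := mul_pos hν hlam
  have hsol := IsSolution.mono hu (Icc_subset_Ici_self : Icc 0 s ⊆ Ici 0)
  have := hsol.energy_le (γ := ν * lam1 L) (C := supNorm L f ^ 2 / L ^ 3 / (ν * lam1 L)) hL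
    (fun K => (hf.measurable K).mono_measure (Measure.restrict_mono Icc_subset_Ici_self le_rfl))
    hγ (by positivity) (by
      filter_upwards [ae_restrict_of_ae_restrict_of_subset Icc_subset_Ici_self
        (hf.ae_waveSum_le hL), ae_restrict_mem measurableSet_Icc] with r hr hrI
      obtain ⟨hfm, hfle⟩ := hr
      refine ⟨fun K => ‖f r K‖ ^ 2 / (ν * lam1 L), fun K => ?_, fun S => ?_⟩
      · by_cases hK : K = 0
        · subst hK
          simp only [(hsol.mem_V r hrI).mean_zero, inner_zero_left, norm_zero]
          simp only [ne_eq, OfNat.ofNat_ne_zero, not_false_eq_true, zero_pow, mul_zero, add_zero]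
          positivity
        -- The dissipation rate is at least `2νλ₁`: one half pays for the decay, the other absorbs
        -- the Young term.
        · have h1 := two_mul_inner_le (u r K) (f r K) hγ
          have h2 := lam1_le_eig hL hK
          have h3 := one_le_helmSymbol hL α K
          have h4 : ‖u r K‖ ^ 2 ≤ helmSymbol L α K * ‖u r K‖ ^ 2 :=
            le_mul_of_one_le_left (sq_nonneg _) h3
          have h5 : ν * lam1 L ≤ ν * eig L K := by gcongr
          have h6 := mul_le_mul h5 h4 (sq_nonneg _) (hγ.le.trans h5)
          have h7 := mul_le_mul_of_nonneg_right h5 (((sq_nonneg _).trans h4))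
          linarith
      · rw [← Finset.sum_div]
        gcongr
        refine le_trans ?_ hfle
        rw [waveSum_zero_eq]
        exact hfm.summable_sq.sum_le_tsum S fun _ _ => sq_nonneg _)
    (right_mem_Icc.mpr hs)
  rw [sub_zero] at this
  refine this.trans (le_of_eq ?_)
  congr 1
  field_simp

/-! ### Nudging: low and high modes. -/

/-- On divergence-free fields the nudging term acts as `(I + β²A)` on the observed low modes. -/
lemma helmholtz_leray_lowModes_sub {r s : ℕ} {w u : Field} (hw : MemV r w) (hu : MemV s u)
    (L β : ℝ) (N : ℕ) (K : Wave) :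
    helmholtz L β (leray (lowModes N w - lowModes N u)) K =
      if K ≠ 0 ∧ waveSq K < (N : ℝ) ^ 2 then helmSymbol L β K • (w K - u K) else 0 := by
  have hdiv : dotWave (w K - u K) K = 0 := by
    have h1 := hw.div_free K
    have h2 := hu.div_free K
    simp only [dotWave] at h1 h2 ⊢
    simp [sub_mul, Finset.sum_sub_distrib, h1, h2]
  rw [helmholtz_apply]
  split_ifs with hK
  · simp [leray, lowModes, hK, hdiv]
  · by_cases h0 : K = 0
    · simp [leray, h0]
    · have : ¬ waveSq K < (N : ℝ) ^ 2 := fun h => hK ⟨h0, h⟩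
      simp [leray, lowModes, this, dotWave]

section Pointwise

variable {E : Type*} [NormedAddCommGroup E] [InnerProductSpace ℝ E] (x y z : E) {η m d : ℝ}

/-- The budget balances exactly: nudging gives `-2ηm|x|²`, the cross term costs `ηm|x|²`, and the
forcing and the decay cost at most `(η/2)m|x|²` each. Viscosity is not needed. -/
lemma nudged_low_mode_le (hη : 0 < η) (hm : 1 ≤ m) (hd : 0 ≤ d) :
    2 * inner ℝ x (z - η • (m • (x - y))) + (η / 2 - 2 * d) * (m * ‖x‖ ^ 2) ≤
      2 / η * ‖z‖ ^ 2 + η * (m * ‖y‖ ^ 2) := by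
  have h1 := two_mul_inner_le x z (half_pos hη)
  rw [show ‖z‖ ^ 2 / (η / 2) = 2 / η * ‖z‖ ^ 2 by field_simp] at h1
  have h2 := mul_le_mul_of_nonneg_left (le_mul_of_one_le_left (sq_nonneg ‖x‖) hm) hη.le
  have h3 := two_mul_inner_le x y one_pos
  rw [one_mul, div_one] at h3
  have h4 := mul_le_mul_of_nonneg_left h3 (mul_nonneg hη.le (zero_le_one.trans hm))
  have h5 : 0 ≤ d * (m * ‖x‖ ^ 2) := by positivity
  rw [inner_sub_right, real_inner_smul_right, real_inner_smul_right, inner_sub_right,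
    real_inner_self_eq_norm_sq]
  linarith

/-- Here there is no nudging, and viscosity alone pays for forcing and decay. The `y` term is added
so that both mode ranges share one bound. -/
lemma nudged_high_mode_le (hη : 0 < η) (hm : 1 ≤ m) (hd : 2 * η ≤ d) :
    2 * inner ℝ x z + (η / 2 - 2 * d) * (m * ‖x‖ ^ 2) ≤
      2 / η * ‖z‖ ^ 2 + η * (m * ‖y‖ ^ 2) := by
  have h1 := two_mul_inner_le x z (half_pos hη)
  rw [show ‖z‖ ^ 2 / (η / 2) = 2 / η * ‖z‖ ^ 2 by field_simp] at h1
  have h2 := mul_le_mul_of_nonneg_left (le_mul_of_one_le_left (sq_nonneg ‖x‖) hm) hη.le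
  have h3 : 0 ≤ m * ‖x‖ ^ 2 := by positivity
  have h4 := mul_le_mul_of_nonneg_right hd h3
  have h5 : 0 ≤ η * (m * ‖x‖ ^ 2) := by positivity
  have h6 : 0 ≤ η * (m * ‖y‖ ^ 2) := by positivity
  linarith

end Pointwise

/-- The nudged forcing `f - η (I + β²A) P_N (w - u)`, mode by mode. -/
def nudgedMode (L β η : ℝ) (N : ℕ) (f w u : Field) (K : Wave) : EuclideanSpace ℂ (Fin 3) :=
  f K - η • (if K ≠ 0 ∧ waveSq K < (N : ℝ) ^ 2 then helmSymbol L β K • (w K - u K) else 0)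

lemma nudging_apply {r s : ℕ} {w u : Field} (hw : MemV r w) (hu : MemV s u) (f : Field)
    (L β η : ℝ) (N : ℕ) (K : Wave) :
    (f - (η : ℂ) • helmholtz L β (leray (lowModes N w - lowModes N u))) K =
      nudgedMode L β η N f w u K := by
  rw [Pi.sub_apply, Pi.smul_apply, helmholtz_leray_lowModes_sub hw hu]
  rfl

lemma nudgedMode_le {s : ℕ} {w : Field} (hw : MemV s w) (hL : 0 < L) (hν : 0 < ν)
    {β η : ℝ} {N : ℕ} (hη : 0 < η) (hN : 1 ≤ N) (hcond : η / (N : ℝ) ^ 2 ≤ ν * lam1 L / 2)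
    (f u : Field) (K : Wave) :
    2 * inner ℝ (w K) (nudgedMode L β η N f w u K) +
        (η / 2 - 2 * ν * eig L K) * (helmSymbol L β K * ‖w K‖ ^ 2) ≤
      2 / η * ‖f K‖ ^ 2 + η * (helmSymbol L β K * ‖u K‖ ^ 2) := by
  have hm := one_le_helmSymbol hL β K
  have he := eig_nonneg hL K
  rw [mul_assoc 2 ν]
  by_cases hK : K = 0
  · have : 0 ≤ helmSymbol L β K := zero_le_one.trans hm
    subst hK
    simp only [hw.mean_zero, inner_zero_left, norm_zero, ne_eq, OfNat.ofNat_ne_zero,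
      not_false_eq_true, zero_pow, mul_zero, add_zero]
    positivity
  unfold nudgedMode
  split_ifs with hlow
  · exact nudged_low_mode_le _ _ _ hη hm (by positivity)
  · rw [smul_zero, sub_zero]
    refine nudged_high_mode_le _ _ _ hη hm ?_
    have hlam := lam1_pos hL
    have hN' : (0 : ℝ) < (N : ℝ) ^ 2 := by positivity
    have hhigh : (N : ℝ) ^ 2 ≤ waveSq K := not_lt.mp fun h => hlow ⟨hK, h⟩
    rw [div_le_iff₀ hN'] at hcond
    have : ν * lam1 L * (N : ℝ) ^ 2 ≤ ν * lam1 L * waveSq K := by gcongr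
    unfold eig
    linarith

lemma sum_forcing_add_energy_le {f u : Field} (hf : MemV 0 f) (hu : MemV 1 u) (hL : 0 < L)
    {β p q Φ E : ℝ} (hp : 0 ≤ p) (hq : 0 ≤ q) (hΦ : waveSum 0 f ≤ Φ) (hE : energy L β u ≤ E)
    (S : Finset Wave) :
    ∑ K ∈ S, (p * ‖f K‖ ^ 2 + q * (helmSymbol L β K * ‖u K‖ ^ 2)) ≤ p * Φ + q * E := by
  rw [Finset.sum_add_distrib, ← Finset.mul_sum, ← Finset.mul_sum]
  have h1 : ∑ K ∈ S, ‖f K‖ ^ 2 ≤ Φ := by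
    refine le_trans ?_ hΦ
    rw [waveSum_zero_eq]
    exact hf.summable_sq.sum_le_tsum S fun _ _ => sq_nonneg _
  have h2 : ∑ K ∈ S, helmSymbol L β K * ‖u K‖ ^ 2 ≤ E :=
    (sum_le_hasSum S (fun K _ => mul_nonneg (helmSymbol_pos hL β K).le (sq_nonneg _))
      (hu.hasSum_energy L β)).trans hE
  gcongr

lemma aestronglyMeasurable_nudgedMode {f w u : ℝ → Field} {μ : Measure ℝ} {K : Wave}
    (hf : AEStronglyMeasurable (fun s => f s K) μ) (hw : AEStronglyMeasurable (fun s => w s K) μ)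
    (hu : AEStronglyMeasurable (fun s => u s K) μ) (L β η : ℝ) (N : ℕ) :
    AEStronglyMeasurable (fun s => nudgedMode L β η N (f s) (w s) (u s) K) μ := by
  have h1 : AEStronglyMeasurable (fun s => w s K - u s K) μ := hw.sub hu
  have h2 : AEStronglyMeasurable (fun s => helmSymbol L β K • (w s K - u s K)) μ :=
    h1.const_smul (helmSymbol L β K)
  have h3 : AEStronglyMeasurable (fun s => if K ≠ 0 ∧ waveSq K < (N : ℝ) ^ 2 then
      helmSymbol L β K • (w s K - u s K) else 0) μ := by
    split_ifs
    · exact h2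
    · exact aestronglyMeasurable_const
  exact hf.sub (h3.const_smul η)

/-- The energy of a solution of the nudged system whose reference field has bounded energy. -/
theorem IsNudgedSolution.energy_le {β η : ℝ} {N : ℕ} {f u w : ℝ → Field} {T₀ T₁ E : ℝ}
    (hw : IsNudgedSolution L ν β η N f u (Icc T₀ T₁) w) (hL : 0 < L) (hν : 0 < ν)
    (hη : 0 < η) (hf : MemLinfH L f) (hT₀ : 0 ≤ T₀) (hN : 1 ≤ N)
    (hcond : η / (N : ℝ) ^ 2 ≤ ν * lam1 L / 2)
    (hu : ∀ s ∈ Icc T₀ T₁, MemV 1 (u s)) (huE : ∀ s ∈ Icc T₀ T₁, energy L β (u s) ≤ E)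
    (humeas : ∀ K, AEStronglyMeasurable (fun s => u s K) (volume.restrict (Icc T₀ T₁)))
    {t : ℝ} (ht : t ∈ Icc T₀ T₁) :
    energy L β (w t) ≤ Real.exp (-(η / 2 * (t - T₀))) * energy L β (w T₀) +
      (4 / η ^ 2 * (supNorm L f ^ 2 / L ^ 3) + 2 * E) := by
  have hsub : Icc T₀ T₁ ⊆ Ici 0 := fun s hs => hT₀.trans hs.1
  have hE : 0 ≤ E := (energy_nonneg hL β (u t)).trans (huE t ht)
  have hwV := hw.mem_V
  have hmeas : ∀ K, AEStronglyMeasurable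
      (fun s => (f s - (η : ℂ) • helmholtz L β (leray (lowModes N (w s) - lowModes N (u s)))) K)
      (volume.restrict (Icc T₀ T₁)) := by
    intro K
    refine (aestronglyMeasurable_nudgedMode
      ((hf.measurable K).mono_measure (Measure.restrict_mono hsub le_rfl))
      ((IsSolution.continuousOn_mode hw hL K (ht.1.trans ht.2)).aestronglyMeasurable
        measurableSet_Icc) (humeas K) L β η N).congr ?_
    filter_upwards [ae_restrict_mem measurableSet_Icc] with s hs
    exact (nudging_apply (hwV s hs) (hu s hs) (f s) L β η N K).symm
  -- Dividing `C` by the rate `η/2` produces the factors `4/η²` and `2`.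
  have := IsSolution.energy_le (γ := η / 2)
    (C := 2 / η * (supNorm L f ^ 2 / L ^ 3) + η * E) hw hL hmeas
    (half_pos hη) (by positivity) (by
      filter_upwards [ae_restrict_of_ae_restrict_of_subset hsub (hf.ae_waveSum_le hL),
        ae_restrict_mem measurableSet_Icc] with s hs hsI
      refine ⟨fun K => 2 / η * ‖f s K‖ ^ 2 + η * (helmSymbol L β K * ‖u s K‖ ^ 2),
        fun K => ?_, sum_forcing_add_energy_le hs.1 (hu s hsI) hL (by positivity) hη.le hs.2
          (huE s hsI)⟩
      rw [nudging_apply (hwV s hsI) (hu s hsI)]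
      exact nudgedMode_le (hwV s hsI) hL hν hη hN hcond _ _ K)
    ht
  refine this.trans (le_of_eq ?_)
  congr 1
  field_simp
  ring

/-! ### The bound on the reference solution, and the conclusion. -/

/-- `‖u(s)‖² + α²‖∇u(s)‖² ≤ M₁²(r)` for all `s ≥ r ≥ 0`. -/
theorem IsBardinaSolution.normSq_le_M1sq {α α₁ MA MB : ℝ} {f u : ℝ → Field}
    (hu : IsBardinaSolution L ν α f u) (hL : 0 < L) (hν : 0 < ν) (hα : 0 ≤ α) (hαα₁ : α ≤ α₁)
    (hf : MemLinfH L f) (hMA : Real.sqrt (normSq L 0 (u 0)) ≤ MA)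
    (hMB : Real.sqrt (normSq L 1 (u 0)) ≤ MB) {r s : ℝ} (hr : 0 ≤ r) (hrs : r ≤ s) :
    normSq L 0 (u s) + α ^ 2 * normSq L 1 (u s) ≤ M1sq L ν α₁ MA MB f r := by
  have hlam := lam1_pos hL
  have hA : normSq L 0 (u 0) ≤ MA ^ 2 := by
    rw [← Real.sq_sqrt (normSq_nonneg hL 0 (u 0))]; gcongr
  have hB : normSq L 1 (u 0) ≤ MB ^ 2 := by
    rw [← Real.sq_sqrt (normSq_nonneg hL 1 (u 0))]; gcongr
  have h0 : L ^ 3 * energy L α (u 0) ≤ MA ^ 2 + α₁ ^ 2 * MB ^ 2 := by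
    rw [← normSq_add_normSq]
    have := normSq_nonneg hL 1 (u 0)
    gcongr
  have h1 := mul_le_mul_of_nonneg_left (hu.energy_le hL hν hf (hr.trans hrs)) (pow_pos hL 3).le
  rw [normSq_add_normSq]
  calc _ ≤ _ := h1
    _ = Real.exp (-(ν * lam1 L * s)) * (L ^ 3 * energy L α (u 0)) +
        1 / (lam1 L ^ 2 * ν ^ 2) * supNorm L f ^ 2 := by field_simp
    _ ≤ M1sq L ν α₁ MA MB f r := by
        unfold M1sq
        have := energy_nonneg hL α (u 0)
        gcongr

end Bardina

end

/-- The length scale `α` lies in `[α₀, α₁]`, `u` solves the simplified Bardina system, and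
`w n` solves the nudged system of the step `n ≥ 1` on `[t n, t (n+1)]`, starting from
`w (n-1) (t n)`; for `n = 1` this is the prescribed initial datum. -/
theorem proposition5p4
    (L ν α α₀ α₁ MA MB : ℝ) (hL : 0 < L) (hν : 0 < ν)
    (hα₀ : 0 < α₀) (hα₀α : α₀ ≤ α) (hαα₁ : α ≤ α₁)
    (f : ℝ → Bardina.Field) (hf : Bardina.MemLinfH L f)
    (u : ℝ → Bardina.Field) (hu : Bardina.IsBardinaSolution L ν α f u)
    (hMA : Real.sqrt (Bardina.normSq L 0 (u 0)) ≤ MA)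
    (hMB : Real.sqrt (Bardina.normSq L 1 (u 0)) ≤ MB)
    (t β η : ℕ → ℝ) (N : ℕ → ℕ) (w : ℕ → ℝ → Bardina.Field)
    (n : ℕ) (hn : 1 ≤ n) (ht₀ : 0 ≤ t n) (ht : t n < t (n + 1))
    (hβ : 0 < β n) (hη : 0 < η n) (hN : 1 ≤ N n)
    (hw : Bardina.IsNudgedSolution L ν (β n) (η n) (N n) f u (Set.Icc (t n) (t (n + 1))) (w n))
    (hinit : w n (t n) = w (n - 1) (t n))
    (hcond : η n / (N n : ℝ) ^ 2 ≤ ν * Bardina.lam1 L / 2) :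
    ∀ s ∈ Set.Icc (t n) (t (n + 1)),
      Bardina.normSq L 0 (w n s) + β n ^ 2 * Bardina.normSq L 1 (w n s) ≤
        Bardina.M4sq L ν α₀ α₁ MA MB f (t n) (β n) (w (n - 1) (t n)) s (η n) := by
  intro s hs
  have hα : 0 < α := hα₀.trans_le hα₀α
  have hL3 : 0 < L ^ 3 := pow_pos hL 3
  have hM := fun r (hr : r ∈ Set.Icc (t n) (t (n + 1))) =>
    hu.normSq_le_M1sq hL hν hα.le hαα₁ hf hMA hMB ht₀ hr.1
  have huV : ∀ r ∈ Set.Icc (t n) (t (n + 1)), Bardina.MemV 1 (u r) := fun r hr =>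
    Bardina.IsSolution.mem_V hu r (ht₀.trans hr.1)
  -- `M₁²` decreases in time, so its value at `t n` serves for the whole step. The constant `2` is
  -- generous: `1` would do, since `M₁² ≥ 0`.
  have huE : ∀ r ∈ Set.Icc (t n) (t (n + 1)), Bardina.energy L (β n) (u r) ≤
      (2 + β n ^ 2 / α₀ ^ 2) * Bardina.M1sq L ν α₁ MA MB f (t n) / L ^ 3 := by
    intro r hr
    rw [le_div_iff₀ hL3, mul_comm, ← Bardina.normSq_add_normSq]
    have h0 := Bardina.normSq_nonneg hL 0 (u r)
    have h1 := Bardina.normSq_nonneg hL 1 (u r)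
    have h2 := hM r hr
    have h3 : α₀ ^ 2 * Bardina.normSq L 1 (u r) ≤ α ^ 2 * Bardina.normSq L 1 (u r) := by gcongr
    have h4 : Bardina.normSq L 0 (u r) ≤ Bardina.M1sq L ν α₁ MA MB f (t n) := by
      have : 0 ≤ α ^ 2 * Bardina.normSq L 1 (u r) := by positivity
      linarith
    have h5 : Bardina.normSq L 1 (u r) ≤ Bardina.M1sq L ν α₁ MA MB f (t n) / α₀ ^ 2 := by
      rw [le_div_iff₀ (by positivity)]
      linarith
    have h6 := mul_le_mul_of_nonneg_left h5 (sq_nonneg (β n))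
    have h7 : β n ^ 2 * (Bardina.M1sq L ν α₁ MA MB f (t n) / α₀ ^ 2) =
      β n ^ 2 / α₀ ^ 2 * Bardina.M1sq L ν α₁ MA MB f (t n) := by ring
    linarith
  have humeas : ∀ K, MeasureTheory.AEStronglyMeasurable (fun r => u r K)
      (MeasureTheory.volume.restrict (Set.Icc (t n) (t (n + 1)))) := fun K =>
    (((Bardina.IsSolution.mono hu Set.Icc_subset_Ici_self).continuousOn_mode hL K
      (ht₀.trans ht.le)).mono (Set.Icc_subset_Icc_left ht₀)).aestronglyMeasurable
      measurableSet_Icc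
  have h := mul_le_mul_of_nonneg_left
    (hw.energy_le hL hν hη hf ht₀ hN hcond huV huE humeas hs) hL3.le
  rw [Bardina.normSq_add_normSq, Bardina.M4sq, Bardina.normSq_add_normSq, ← hinit]
  refine h.trans (le_of_eq ?_)
  field_simp
  ring
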